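/- Let $L$ be a countable language with only function and constant symbols, and let $\mathbf V$ be a variety of $L$-algebras (the class of all $L$-structures satisfying a given set of identities). Let $\mathcal F_{\mathbf V}$ be the class of free algebras of $\mathbf V$ and $\mathcal F^\infty_{\mathbf V}$ the class of those with an infinite free generating set; let $*$ be the free product (coproduct) in $\mathbf V$. For $A,B\in\mathcal F_{\mathbf V}$ with $A\le B$ write $A\le^{\mathrm{ff}}_* B$ if $B=A*C$ for some subalgebra $C\in\mathcal F_{\mathbf V}$ of $B$. For a subset $S$ of a structure $M$ let $\mathrm{dcl}^{\mathrm{qf}}_M(S)$ be the quantifier-free definable closure of $S$ in $M$: the least set $T$ with $S\subseteq T\subseteq M$ that contains every $d\in M$ which is the unique solution in $M$ of a quantifier-free formula with parameters in $T$. Call $A\le B$ with sequences $(a_i)_{i<\omega}$ in $A$, $(b_i)_{i<\omega}$ in $B$ an *RCP pair* if * (a) $A$ is freely generated in $\mathbf V$ by $\{a_i:i<\omega\}$ and $\langle a_j:j\le i\rangle\le^{\mathrm{ff}}_* B$ for every $i<\omega$; * (b) $A\not\le^{\mathrm{ff}}_* B*C$ for every $C\in\mathcal F_{\mathbf V}$;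 * (c) $B$ is freely generated in $\mathbf V$ by $\{b_i:i<\omega\}$ and $\mathrm{dcl}^{\mathrm{qf}}_B(Ab_0)=B$. $\mathbf V$ satisfies the *Reinforced Construction Principle* (RCP) if an RCP pair exists. An *AEC-covering* of $(\mathcal F_{\mathbf V},\le^{\mathrm{ff}}_*)$ is an abstract elementary class $(\mathcal K,\preccurlyeq)$ of $L$-structures with amalgamation and joint embedding such that $\mathcal F^\infty_{\mathbf V}\subseteq\mathcal K$, and $A\le^{\mathrm{ff}}_* B$ implies $A\preccurlyeq B$ for $A,B\in\mathcal F_{\mathbf V}\cap\mathcal K$. A *monster model at* $\kappa$ is an $M\in\mathcal K$ such that every member of $\mathcal K$ of size $\le\kappa$ embeds strongly into $M$ (that is, with image $\preccurlyeq M$) and every isomorphism between two strong submodels of $M$ of size $<\kappa$ extends to an automorphism of $M$. The covering is *strong enough* if * (i) for all $A,B,C\in\mathcal F^\infty_{\mathbf V}$, if $A\preccurlyeq B$ then $A*C\preccurlyeq B*C$, where $A*C$ is read as the subalgebra of $B*C$ generated by $A$ and $C$; * (ii) for every RCP pair $A\le B$ and every $M\in\mathcal K$ with $B\preccurlyeq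 M$, $\mathrm{dcl}^{\mathrm{qf}}_B(Ab_0)=\mathrm{dcl}^{\mathrm{qf}}_M(Ab_0)$; * (iii) for all sufficiently large $\kappa$, every monster model $\mathfrak M$ at $\kappa$, every RCP pair $A\le B$ with $B\preccurlyeq\mathfrak M$ and every automorphism $f$ of $\mathfrak M$ fixing $A$ pointwise, $\mathrm{dcl}^{\mathrm{qf}}_{\mathfrak M}(Ab_0)=\mathrm{dcl}^{\mathrm{qf}}_{\mathfrak M}(Af(b_0))$. **Theorem.** Let $\mathbf V$ be a variety of algebras in a countable language which satisfies RCP, and let $(\mathcal K,\preccurlyeq)$ be a strong enough AEC-covering of $(\mathcal F_{\mathbf V},\le^{\mathrm{ff}}_*)$. Then $(\mathcal K,\preccurlyeq)$ is not superstable, i.e. there is no tail of cardinals on which it is $\lambda$-stable: for every cardinal $\mu$ there is $\lambda\ge\mu$ and a model $A\in\mathcal K$ of size $\lambda$ over which there are more than $\lambda$ Galois types of elements, where Galois types over $A$ are classes of elements of strong extensions of $A$, two elements being identified when their extensions can be strongly amalgamated over $A$ so that the elements coincide. The same holds with types computed in monster models: for every $\mu$ there is $\lambda\ge\mu$ such that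 in every monster model $\mathfrak M$ at any $\kappa>\lambda$ there is $A\preccurlyeq\mathfrak M$ of size $\lambda$ for which the automorphisms of $\mathfrak M$ fixing $A$ pointwise have more than $\lambda$ orbits on $\mathfrak M$. -/

import Mathlib

open FirstOrder Cardinal

universe u

/-! ### Varieties of algebras, free algebras, free products -/

/-- A variety of `L`-algebras, presented by a set of identities `s ≈ t` between `L`-terms in
variables indexed by `ℕ`. -/
abbrev AlgVariety (L : FirstOrder.Language.{0, 0}) : Type :=
  Set (L.Term ℕ × L.Term ℕ)

namespace AlgVariety

variable {L : FirstOrder.Language.{0, 0}} (V : AlgVariety L)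

/-- `M` is an algebra of the variety `V`, i.e. it satisfies all the identities of `V`. -/
def Mem (M : Type u) [L.Structure M] : Prop :=
  ∀ e ∈ V, ∀ v : ℕ → M, e.1.realize v = e.2.realize v

/-- The algebra `M ∈ V` is freely generated in `V` by the (injectively indexed) family `x`. -/
structure FreelyGenerates {M : Type u} [L.Structure M] {ι : Type*} (x : ι → M) : Prop where
  mem : V.Mem M
  injective : Function.Injective x
  lift : ∀ (D : Type u) [L.Structure D], V.Mem D → ∀ v : ι → D,
    ∃! h : M →[L] D, ∀ i, h (x i) = v i

/-- `M` belongs to `𝓕_V`: it is a free algebra of `V`, of any rank. -/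
def IsFree (M : Type u) [L.Structure M] : Prop :=
  ∃ (ι : Type u) (x : ι → M), V.FreelyGenerates x

/-- `M` belongs to `𝓕^∞_V`: it is a free algebra of `V` of infinite rank. -/
def IsFreeInf (M : Type u) [L.Structure M] : Prop :=
  ∃ (ι : Type u) (x : ι → M), Infinite ι ∧ V.FreelyGenerates x

/-- `P = A ∗ C`: the algebra `P ∈ V` is the free product in `V` (the coproduct in the category of
algebras of `V`) of its subalgebras `A` and `C`. -/
def IsFreeProduct {P : Type u} [L.Structure P] (A C : L.Substructure P) : Prop :=
  V.Mem P ∧ ∀ (D : Type u) [L.Structure D], V.Mem D → ∀ (f : A →[L] D) (g : C →[L] D),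
    ∃! h : P →[L] D, (∀ a : A, h a = f a) ∧ (∀ c : C, h c = g c)

/-- `A ≤∗^ff B`: `A` and `B` are free in `V`, and `B = A ∗ C` for some free `C`. -/
def FreeFactor {B : Type u} [L.Structure B] (A : L.Substructure B) : Prop :=
  V.IsFree A ∧ V.IsFree B ∧ ∃ C : L.Substructure B, V.IsFree C ∧ V.IsFreeProduct A C

end AlgVariety

/-! ### Quantifier-free definable closure -/

/-- `d` is the unique element of `M` that satisfies some quantifier-free formula with parameters
from `S`. -/
def QFDefinableOver (L : FirstOrder.Language.{0, 0}) {M : Type u} [L.Structure M]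
    (S : Set M) (d : M) : Prop :=
  ∃ φ : L.Formula (S ⊕ Unit), φ.IsQF ∧
    ∀ x : M, φ.Realize (Sum.elim (fun s : S => (s : M)) (fun _ => x)) ↔ x = d

/-- The quantifier-free definable closure `dcl^qf_M(S)`: the least subset of `M` that contains `S`
and contains every element which is quantifier-free definable in `M` over it. (The operator is
iterated, as it must be in order to be a closure operator: an element defined without quantifiers
from `d`, where `d` is defined without quantifiers over `S`, need not itself be the unique solution
of a quantifier-free formula over `S`.) -/
def qfDcl (L : FirstOrder.Language.{0, 0}) {M : Type u} [L.Structure M] (S : Set M) : Set M :=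
  ⋂₀ {T : Set M | S ⊆ T ∧ ∀ d, QFDefinableOver L T d → d ∈ T}

/-! ### The reinforced construction principle -/

namespace AlgVariety

variable {L : FirstOrder.Language.{0, 0}} (V : AlgVariety L)

/-- The algebras `A ≤ B`, with free generators `a i` of `A` and `b i` of `B`, witness the
reinforced construction principle. -/
structure IsRCPPair {B : Type u} [L.Structure B] (A : L.Substructure B) (a : ℕ → A)
    (b : ℕ → B) : Prop where
  /-- `A` is freely generated by the `a i`. -/
  free_left : V.FreelyGenerates a
  /-- `B` is freely generated by the `b i`. -/
  free_right : V.FreelyGenerates b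
  /-- Finite initial segments of the generators of `A` generate free factors of `B`. -/
  freeFactor : ∀ i : ℕ, V.FreeFactor
    (FirstOrder.Language.Substructure.closure L ((fun j => (a j : B)) '' Set.Iic i))
  /-- `A` is not a free factor of `P = B ∗ C`, for any free algebra `C`. -/
  not_freeFactor : ∀ (P : Type u) [L.Structure P] (e : B ↪[L] P) (C : L.Substructure P),
    V.IsFree C → V.IsFreeProduct e.toHom.range C → ¬ V.FreeFactor (A.map e.toHom)
  /-- `dcl^qf_B(A b₀) = B`. -/
  qfDcl_eq : qfDcl L ((A : Set B) ∪ {b 0}) = Set.univ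

/-- The reinforced construction principle for `V`. -/
def RCP : Prop :=
  ∃ (B : Type u) (_ : L.Structure B) (A : L.Substructure B) (a : ℕ → A) (b : ℕ → B),
    V.IsRCPPair A a b

end AlgVariety

/-! ### Abstract elementary classes -/

/-- A class of `L`-structures together with, for every `L`-structure `M`, a set of distinguished
substructures of `M`: those `A` with `A ≼ M`. -/
structure StrongClass (L : FirstOrder.Language.{0, 0}) where
  /-- `M` belongs to the class `𝒦`. -/
  Mem : ∀ (M : Type u) [L.Structure M], Prop
  /-- `A ≼ M`. -/
  Strong : ∀ {M : Type u} [L.Structure M], L.Substructure M → Prop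

namespace StrongClass

variable {L : FirstOrder.Language.{0, 0}} (K : StrongClass.{u} L)

/-- `A ≼ B`, for substructures `A` and `B` of a common structure. -/
def StrongIn {M : Type u} [L.Structure M] (A B : L.Substructure M) : Prop :=
  A ≤ B ∧ K.Strong (A.comap B.subtype.toHom)

/-- `(𝒦, ≼)` is an abstract elementary class. -/
structure IsAEC : Prop where
  /-- `≼` is a relation on `𝒦`. -/
  mem_of_strong : ∀ {M : Type u} [L.Structure M] (A : L.Substructure M),
    K.Strong A → K.Mem A ∧ K.Mem M
  /-- `𝒦` is closed under isomorphism. -/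
  mem_equiv : ∀ {M N : Type u} [L.Structure M] [L.Structure N] (_ : M ≃[L] N),
    K.Mem M → K.Mem N
  /-- `≼` is closed under isomorphism. -/
  strong_equiv : ∀ {M N : Type u} [L.Structure M] [L.Structure N] (e : M ≃[L] N)
    (A : L.Substructure M), K.Strong A → K.Strong (A.map e.toHom)
  /-- `≼` is reflexive. -/
  refl : ∀ {M : Type u} [L.Structure M], K.Mem M → K.Strong (⊤ : L.Substructure M)
  /-- `≼` is transitive. (Antisymmetry is automatic.) -/
  trans : ∀ {M : Type u} [L.Structure M] (A B : L.Substructure M),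
    K.StrongIn A B → K.Strong B → K.Strong A
  /-- The Tarski–Vaught axioms, for increasing continuous chains indexed by a nonempty
  well-order: the union is in `𝒦`, it is a strong extension of all members of the chain, and
  (smoothness) it is a strong submodel of any common strong extension. -/
  chain : ∀ {N : Type u} [L.Structure N] {ι : Type u} [LinearOrder ι] [WellFoundedLT ι]
    [Nonempty ι] (A : ι → L.Substructure N),
    (∀ i j, i ≤ j → K.StrongIn (A i) (A j)) →
    (∀ i, Order.IsSuccLimit i → A i = ⨆ j : Set.Iio i, A j) →
    K.Mem (⨆ i, A i : L.Substructure N) ∧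
    (∀ j, K.StrongIn (A j) (⨆ i, A i)) ∧
    ((∀ i, K.Strong (A i)) → K.Strong (⨆ i, A i))
  /-- The coherence axiom. -/
  coherence : ∀ {M : Type u} [L.Structure M] (A B : L.Substructure M),
    K.Strong A → K.Strong B → A ≤ B → K.StrongIn A B
  /-- The Löwenheim–Skolem–Tarski axiom. -/
  lowenheimSkolem : ∃ κ : Cardinal.{u}, ℵ₀ ≤ κ ∧ Cardinal.lift.{u} L.card ≤ κ ∧
    ∀ {M : Type u} [L.Structure M], K.Mem M → ∀ S : Set M,
      ∃ C : L.Substructure M, S ⊆ C ∧ K.Strong C ∧ #C ≤ #S + κ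

/-- A strong embedding: its image is a strong submodel of the target. -/
def IsStrongEmbedding {M N : Type u} [L.Structure M] [L.Structure N] (f : M ↪[L] N) : Prop :=
  K.Strong f.toHom.range

/-- The amalgamation property. -/
def AP : Prop :=
  ∀ (M₀ M₁ M₂ : Type u) [L.Structure M₀] [L.Structure M₁] [L.Structure M₂],
    K.Mem M₀ → K.Mem M₁ → K.Mem M₂ →
    ∀ (f₁ : M₀ ↪[L] M₁) (f₂ : M₀ ↪[L] M₂), K.IsStrongEmbedding f₁ → K.IsStrongEmbedding f₂ →
    ∃ (N : Type u) (_ : L.Structure N) (g₁ : M₁ ↪[L] N) (g₂ : M₂ ↪[L] N), K.Mem N ∧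
      K.IsStrongEmbedding g₁ ∧ K.IsStrongEmbedding g₂ ∧ ∀ x, g₁ (f₁ x) = g₂ (f₂ x)

/-- The joint embedding property. -/
def JEP : Prop :=
  ∀ (M₁ M₂ : Type u) [L.Structure M₁] [L.Structure M₂], K.Mem M₁ → K.Mem M₂ →
    ∃ (N : Type u) (_ : L.Structure N) (g₁ : M₁ ↪[L] N) (g₂ : M₂ ↪[L] N), K.Mem N ∧
      K.IsStrongEmbedding g₁ ∧ K.IsStrongEmbedding g₂

/-! ### Monster models, Galois types, superstability -/

/-- `M ∈ 𝒦` is a monster model at `κ`: it is `(κ, ≼)`-universal and `(κ, ≼)`-homogeneous. -/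
structure IsMonster (κ : Cardinal.{u}) (M : Type u) [L.Structure M] : Prop where
  mem : K.Mem M
  universal : ∀ (C : Type u) [L.Structure C], K.Mem C → #C ≤ κ →
    ∃ f : C ↪[L] M, K.IsStrongEmbedding f
  homogeneous : ∀ A₀ A₁ : L.Substructure M, K.Strong A₀ → K.Strong A₁ → #A₀ < κ → #A₁ < κ →
    ∀ f : A₀ ≃[L] A₁, ∃ π : M ≃[L] M, ∀ x : A₀, π x = f x

/-- `a` and `b` have the same orbit under the automorphisms of `M` that fix `A` pointwise. -/
def SameOrbit {M : Type u} [L.Structure M] (A : L.Substructure M) (a b : M) : Prop :=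
  ∃ π : M ≃[L] M, (∀ x ∈ A, π x = x) ∧ π a = b

/-- The set of Galois types over `A`, computed in `M`: orbits of elements of `M` under the
automorphisms of `M` that fix `A` pointwise. -/
def OrbitTypes {M : Type u} [L.Structure M] (A : L.Substructure M) : Type u :=
  Quot (SameOrbit A)

/-- Superstability in terms of types computed in monster models: on a tail of cardinals `lam`, in
some monster model at some `κ > lam` there are at most `lam` Galois types over each strong submodel
of size `lam`. -/
def MonsterSuperstable : Prop :=
  ∃ μ : Cardinal.{u}, ∀ lam : Cardinal.{u}, μ ≤ lam →
    ∃ κ : Cardinal.{u}, lam < κ ∧ ∃ (M : Type u) (_ : L.Structure M), K.IsMonster κ M ∧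
      ∀ A : L.Substructure M, K.Strong A → #A = lam → #(OrbitTypes A) ≤ lam

/-- An element `pt` of a strong extension of `A` (given by a strong embedding of `A`). -/
structure PointedExt (A : Type u) [L.Structure A] where
  /-- the extension -/
  N : Type u
  /-- its structure -/
  str : L.Structure N
  mem : K.Mem N
  /-- the embedding of `A` -/
  emb : A ↪[L] N
  strong : K.IsStrongEmbedding emb
  /-- the element -/
  pt : N

/-- Two pointed strong extensions of `A` can be amalgamated over `A` with identification of their
points. -/
def SameGaloisType {A : Type u} [L.Structure A] (p q : K.PointedExt A) : Prop :=
  letI := p.str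
  letI := q.str
  ∃ (P : Type u) (_ : L.Structure P) (g : p.N ↪[L] P) (h : q.N ↪[L] P), K.Mem P ∧
    K.IsStrongEmbedding g ∧ K.IsStrongEmbedding h ∧
    (∀ x, g (p.emb x) = h (q.emb x)) ∧ g p.pt = h q.pt

/-- The Galois types over the model `A`, defined without reference to a monster model. -/
def GaloisTypes (A : Type u) [L.Structure A] : Type (u + 1) :=
  Quot (K.SameGaloisType (A := A))

/-- `(𝒦, ≼)` is stable in `lam`: over each model of size `lam` there are at most `lam` types. -/
def StableIn (lam : Cardinal.{u}) : Prop :=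
  ∀ (A : Type u) [L.Structure A], K.Mem A → #A = lam →
    #(K.GaloisTypes A) ≤ Cardinal.lift.{u + 1} lam

/-- `(𝒦, ≼)` is superstable: it is stable on a tail of cardinals. -/
def Superstable : Prop :=
  ∃ μ : Cardinal.{u}, ∀ lam : Cardinal.{u}, μ ≤ lam → K.StableIn lam

/-! ### Coverings -/

/-- `(𝒦, ≼)` is an AEC-covering of `(𝓕_V, ≤∗^ff)`. -/
structure IsCovering (V : AlgVariety L) : Prop where
  mem_of_isFreeInf : ∀ (M : Type u) [L.Structure M], V.IsFreeInf M → K.Mem M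
  isAEC : K.IsAEC
  strong_of_freeFactor : ∀ (B : Type u) [L.Structure B] (A : L.Substructure B),
    K.Mem A → K.Mem B → V.FreeFactor A → K.Strong A
  ap : K.AP
  jep : K.JEP

/-- The covering `(𝒦, ≼)` of `(𝓕_V, ≤∗^ff)` is strong enough. -/
structure IsStrongEnough (V : AlgVariety L) : Prop where
  /-- `A ≼ B` implies `A ∗ C ≼ B ∗ C`. Here `B ∗ C = P`, and `A ∗ C` is the subalgebra of `P`
  generated by `A` and `C`. -/
  freeProduct : ∀ (P : Type u) [L.Structure P] (A B C : L.Substructure P),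
    V.IsFreeInf A → V.IsFreeInf B → V.IsFreeInf C → V.IsFreeProduct B C →
    K.StrongIn A B → K.Strong (A ⊔ C)
  /-- If `(A, B)` witnesses the reinforced construction principle and `B ≼ M`, then
  `dcl^qf_B(A b₀) = dcl^qf_M(A b₀)`. -/
  qfDcl_eq : ∀ (M : Type u) [L.Structure M] (B : L.Substructure M) (A : L.Substructure B)
    (a : ℕ → A) (b : ℕ → B), V.IsRCPPair A a b → K.Strong B →
    Subtype.val '' qfDcl L ((A : Set B) ∪ {b 0}) =
      qfDcl L ((Subtype.val '' (A : Set B)) ∪ {(b 0 : M)})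
  /-- If `(A, B)` witnesses the reinforced construction principle, `B ≼ M` for a (large enough)
  monster model `M`, and `f` is an automorphism of `M` that fixes `A` pointwise, then
  `dcl^qf_M(A b₀) = dcl^qf_M(A f(b₀))`. -/
  qfDcl_automorphism : ∃ κ₀ : Cardinal.{u}, ∀ κ : Cardinal.{u}, κ₀ ≤ κ →
    ∀ (M : Type u) [L.Structure M], K.IsMonster κ M →
    ∀ (B : L.Substructure M) (A : L.Substructure B) (a : ℕ → A) (b : ℕ → B),
    V.IsRCPPair A a b → K.Strong B →
    ∀ f : M ≃[L] M, (∀ x : A, f ((x : B) : M) = ((x : B) : M)) →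
    qfDcl L ((Subtype.val '' (A : Set B)) ∪ {(b 0 : M)}) =
      qfDcl L ((Subtype.val '' (A : Set B)) ∪ {f (b 0 : M)})

end StrongClass

/-!
Let `A ≤ B` be an RCP pair with bases `a`, `b`, let `|Λ| = λ < λ ^ ℵ₀`, and let `F` be free on
generators `x t` indexed by the finite sequences `t` of elements of `Λ`. For a branch `η : ℕ → Λ`
glue `B` to `F` by identifying `a k` with `x (η|k)`. The result `N η` is free, and `F` is strong in
it as the union of a chain of free factors, so `b₀ ∈ N η` realizes a Galois type over `F`.

Suppose that `η ≠ ν`, splitting at `n`, yield the same type, so that `N η` and `N ν` embed strongly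
into some `M` over `F` with the same `b₀`. Let `D` be free on `d k` for `k > n`. Sending `d` to the
tail of the other branch embeds `P = B ∗ D` strongly into `N η` and into `N ν`; in `M` the two
embeddings agree on `b₀` and on `a k` for `k ≤ n`, and are interchanged by `a k ↔ d k` for `k > n`.
As `A ∗ D ≤ B ∗ D` is again an RCP pair, condition (ii) shows that both images are the
quantifier-free definable closure of one and the same set. Hence the embeddings differ by an
automorphism of `P` that fixes `a k` for `k ≤ n` and maps `a k` to `d k` for `k > n`. Since
`⟨a k : k ≤ n⟩ ∗ D` is a free factor of `P`, so is its preimage `A`, contradicting (b). Thus there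
are `λ ^ ℵ₀ > λ` types over `F`.
-/

section

open FirstOrder.Language

/-! ### Free generation -/

/-- The family `x`, regarded as a family of elements of the substructure it generates. -/
def toClosureRange (L : FirstOrder.Language.{0, 0}) {M : Type*} [L.Structure M] {ι : Type*}
    (x : ι → M) (i : ι) : Substructure.closure L (Set.range x) :=
  ⟨x i, Substructure.subset_closure (Set.mem_range_self i)⟩

theorem exists_realize_eq_of_mem_closure_range {L : FirstOrder.Language.{0, 0}} {M : Type*}
    [L.Structure M] {ι : Type*} {x : ι → M} {m : M}
    (hm : m ∈ Substructure.closure L (Set.range x)) : ∃ t : L.Term ι, t.realize x = m := by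
  obtain ⟨t, rfl⟩ := Substructure.mem_closure_iff_exists_term.1 hm
  refine ⟨t.relabel (Set.rangeSplitting x), ?_⟩
  rw [Term.realize_relabel]
  exact congrArg (fun v => t.realize v) (funext (Set.apply_rangeSplitting x))

theorem exists_equiv_of_range_eq {L : FirstOrder.Language.{0, 0}} {M N P : Type*}
    [L.Structure M] [L.Structure N] [L.Structure P] (f : M ↪[L] P) (g : N ↪[L] P)
    (h : f.toHom.range = g.toHom.range) : ∃ φ : M ≃[L] N, ∀ m, g (φ m) = f m := by
  have hψ : ∃ ψ : f.toHom.range ≃[L] g.toHom.range, ∀ p, (ψ p : P) = p := by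
    rw [h]
    exact ⟨.refl L _, fun _ => rfl⟩
  obtain ⟨ψ, hψ⟩ := hψ
  refine ⟨(g.equivRange.symm.comp ψ).comp f.equivRange, fun m => ?_⟩
  calc g (g.equivRange.symm (ψ (f.equivRange m)))
      = g.equivRange (g.equivRange.symm (ψ (f.equivRange m))) := rfl
    _ = ψ (f.equivRange m) := by rw [Language.Equiv.apply_symm_apply]
    _ = f m := hψ _

namespace AlgVariety

variable {L : FirstOrder.Language.{0, 0}} {V : AlgVariety L}
  {M N P : Type u} [L.Structure M] [L.Structure N] [L.Structure P] {ι κ : Type*}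

theorem Mem.of_injective (hN : V.Mem N) (f : M →[L] N) (hf : Function.Injective f) : V.Mem M :=
  fun e he v => hf <| by simpa only [HomClass.realize_term] using hN e he (f ∘ v)

theorem Mem.substructure (hN : V.Mem N) (A : L.Substructure N) : V.Mem A :=
  hN.of_injective A.subtype.toHom A.subtype.injective

theorem Mem.equiv (hN : V.Mem N) (φ : N ≃[L] M) : V.Mem M :=
  hN.of_injective φ.symm.toHom φ.symm.injective

variable (V) in
/-- The variety has an algebra with more than one element. In a trivial variety no family with
two members generates freely, since free generators are required to be distinct. -/
def IsNontrivial : Prop :=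
  ∃ (D : Type u) (_ : L.Structure D), V.Mem D ∧ Nontrivial D

variable (V) in
/-- The family `z` is independent in the sense of universal algebra: terms agree on `z` only if
the corresponding identity holds in the variety. -/
def Indep (z : ι → M) : Prop :=
  ∀ s t : L.Term ι, s.realize z = t.realize z →
    ∀ (D : Type u) [L.Structure D], V.Mem D → ∀ v : ι → D, s.realize v = t.realize v

namespace Indep

variable {z : ι → M}

theorem of_comp_hom (f : M →[L] N) (hz : V.Indep (f ∘ z)) : V.Indep z :=
  fun s t hst => hz s t <| by simp only [HomClass.realize_term, hst]

theorem map (hz : V.Indep z) (f : M →[L] N) (hf : Function.Injective f) : V.Indep (f ∘ z) :=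
  fun s t hst => hz s t <| hf <| by simpa only [HomClass.realize_term] using hst

theorem comp_injective (hz : V.Indep z) {σ : κ → ι} (hσ : Function.Injective σ) :
    V.Indep (z ∘ σ) := by
  intro s t hst D _ hD v
  have : Nonempty D := ⟨s.realize v⟩
  obtain ⟨w, rfl⟩ := hσ.surjective_comp_right v
  simpa only [Term.realize_relabel] using
    hz (s.relabel σ) (t.relabel σ) (by simpa only [Term.realize_relabel] using hst) D hD w

theorem of_forall_finset (hz : ∀ S : Finset ι, V.Indep fun i : S => z i) : V.Indep z := by
  classical
  intro s t hst D _ hD v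
  have hs : (s.varFinset : Set ι) ⊆ (s.varFinset ∪ t.varFinset : Finset ι) :=
    Finset.coe_subset.2 Finset.subset_union_left
  have ht : (t.varFinset : Set ι) ⊆ (s.varFinset ∪ t.varFinset : Finset ι) :=
    Finset.coe_subset.2 Finset.subset_union_right
  have h := hz _ (s.restrictVar (Set.inclusion hs)) (t.restrictVar (Set.inclusion ht))
    (((Term.realize_restrictVar' hs).trans hst).trans (Term.realize_restrictVar' ht).symm)
    D hD fun i => v i
  exact ((Term.realize_restrictVar' hs).symm.trans h).trans (Term.realize_restrictVar' ht)

end Indep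

namespace FreelyGenerates

variable {x : ι → M}

theorem hom_ext (hx : V.FreelyGenerates x) {D : Type u} [L.Structure D] (hD : V.Mem D)
    {f g : M →[L] D} (h : ∀ i, f (x i) = g (x i)) : f = g :=
  (hx.lift D hD (g ∘ x)).unique h fun _ => rfl

theorem exists_hom (hx : V.FreelyGenerates x) {D : Type u} [L.Structure D] (hD : V.Mem D)
    (v : ι → D) : ∃ f : M →[L] D, ∀ i, f (x i) = v i :=
  (hx.lift D hD v).exists

theorem closure_range (hx : V.FreelyGenerates x) :
    Substructure.closure L (Set.range x) = ⊤ := by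
  obtain ⟨f, hf⟩ := hx.exists_hom (hx.mem.substructure _) (toClosureRange L x)
  have h : (Substructure.subtype _).toHom.comp f = Hom.id L M :=
    hx.hom_ext hx.mem fun i => congrArg Subtype.val (hf i)
  refine eq_top_iff.2 fun m _ => ?_
  rw [← show (f m : M) = m from DFunLike.congr_fun h m]
  exact (f m).2

theorem closure_range_comp (hx : V.FreelyGenerates x) (f : M →[L] N) :
    Substructure.closure L (Set.range (f ∘ x)) = f.range := by
  rw [Hom.range_eq_map, ← hx.closure_range, Substructure.map_closure, Set.range_comp]

theorem closure_range_coe {A : L.Substructure P} {x : ι → A} (hx : V.FreelyGenerates x) :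
    Substructure.closure L (Set.range fun i => (x i : P)) = A :=
  (hx.closure_range_comp A.subtype.toHom).trans A.range_subtype

theorem indep (hx : V.FreelyGenerates x) : V.Indep x := by
  intro s t hst D _ hD v
  obtain ⟨f, hf⟩ := hx.exists_hom hD v
  obtain rfl : f ∘ x = v := funext hf
  rw [HomClass.realize_term, HomClass.realize_term, hst]

theorem isNontrivial [Nontrivial ι] (hx : V.FreelyGenerates x) : V.IsNontrivial.{u} :=
  ⟨M, _, hx.mem, hx.injective.nontrivial⟩

theorem of_lift (hV : V.IsNontrivial.{u}) (hM : V.Mem M)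
    (hl : ∀ (D : Type u) [L.Structure D], V.Mem D → ∀ v : ι → D,
      ∃! h : M →[L] D, ∀ i, h (x i) = v i) : V.FreelyGenerates x := by
  refine ⟨hM, fun i j hij => ?_, hl⟩
  by_contra hne
  obtain ⟨D, _, hD, p, q, hpq⟩ := hV
  classical
  obtain ⟨h, hh, -⟩ := hl D hD (Function.update (fun _ => p) i q)
  have hp : h (x j) = p := by rw [hh, Function.update_of_ne (Ne.symm hne)]
  have hq : h (x i) = q := by rw [hh, Function.update_self]
  exact hpq (hp.symm.trans (hij ▸ hq))

theorem reindex (hx : V.FreelyGenerates x) (σ : κ ≃ ι) {y : κ → M} (hy : ∀ k, y k = x (σ k)) :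
    V.FreelyGenerates y := by
  obtain rfl : y = x ∘ σ := funext hy
  refine ⟨hx.mem, hx.injective.comp σ.injective, fun D _ hD v => ?_⟩
  obtain ⟨h, hh, hu⟩ := hx.lift D hD (v ∘ σ.symm)
  exact ⟨h, fun k => by simp [hh], fun g hg => hu g fun i => by simpa using hg (σ.symm i)⟩

theorem map_equiv (hx : V.FreelyGenerates x) (φ : M ≃[L] N) : V.FreelyGenerates (φ ∘ x) := by
  refine ⟨hx.mem.equiv φ, φ.injective.comp hx.injective, fun D _ hD v => ?_⟩
  obtain ⟨h, hh, hu⟩ := hx.lift D hD v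
  refine ⟨h.comp φ.symm.toHom, fun i => by simp [hh], fun g hg => ?_⟩
  ext y
  simpa using DFunLike.congr_fun (hu (g.comp φ.toHom) hg) (φ.symm y)

theorem isFree (hx : V.FreelyGenerates x) : V.IsFree M :=
  ⟨Set.range x, Subtype.val,
    hx.reindex (Equiv.ofInjective x hx.injective).symm fun y =>
      (Equiv.apply_ofInjective_symm _ y).symm⟩

theorem isFreeInf [Infinite ι] (hx : V.FreelyGenerates x) : V.IsFreeInf M :=
  ⟨Set.range x, Subtype.val, (Set.infinite_range_of_injective hx.injective).to_subtype,
    hx.reindex (Equiv.ofInjective x hx.injective).symm fun y =>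
      (Equiv.apply_ofInjective_symm _ y).symm⟩

variable {e : N →[L] P} {b : ι → N} {d : κ → P}

theorem existsUnique_extend (hb : V.FreelyGenerates b)
    (h : V.FreelyGenerates (Sum.elim (e ∘ b) d)) {D : Type u} [L.Structure D] (hD : V.Mem D)
    (f : N →[L] D) (v : κ → D) :
    ∃! g : P →[L] D, (∀ m, g (e m) = f m) ∧ ∀ k, g (d k) = v k := by
  obtain ⟨g, hg⟩ := h.exists_hom hD (Sum.elim (f ∘ b) v)
  have hge : g.comp e = f := hb.hom_ext hD fun i => hg (Sum.inl i)
  refine ⟨g, ⟨DFunLike.congr_fun hge, fun k => hg (Sum.inr k)⟩, fun g' hg' => h.hom_ext hD ?_⟩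
  rintro (i | k)
  · exact (hg'.1 (b i)).trans (hg (Sum.inl i)).symm
  · exact (hg'.2 k).trans (hg (Sum.inr k)).symm

theorem of_existsUnique_extend (hV : V.IsNontrivial.{u}) (hb : V.FreelyGenerates b)
    (hP : V.Mem P) (h : ∀ (D : Type u) [L.Structure D], V.Mem D → ∀ (f : N →[L] D) (v : κ → D),
      ∃! g : P →[L] D, (∀ m, g (e m) = f m) ∧ ∀ k, g (d k) = v k) :
    V.FreelyGenerates (Sum.elim (e ∘ b) d) := by
  refine .of_lift hV hP fun D _ hD v => ?_
  obtain ⟨f, hf⟩ := hb.exists_hom hD (v ∘ Sum.inl)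
  obtain ⟨g, ⟨hge, hgd⟩, hu⟩ := h D hD f (v ∘ Sum.inr)
  refine ⟨g, Sum.rec (fun i => (hge _).trans (hf i)) hgd, fun g' hg' => hu g' ⟨?_, ?_⟩⟩
  · have hg'e : g'.comp e = f := hb.hom_ext hD fun i => (hg' (Sum.inl i)).trans (hf i).symm
    exact DFunLike.congr_fun hg'e
  · exact fun k => hg' (Sum.inr k)

theorem exchange (hV : V.IsNontrivial.{u}) {κ' : Type*} {b' : κ' → N}
    (h : V.FreelyGenerates (Sum.elim (e ∘ b) d)) (hb : V.FreelyGenerates b)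
    (hb' : V.FreelyGenerates b') : V.FreelyGenerates (Sum.elim (e ∘ b') d) :=
  .of_existsUnique_extend hV hb' h.mem fun _ _ hD f v => hb.existsUnique_extend h hD f v

end FreelyGenerates

theorem IsFreeProduct.freelyGenerates (hV : V.IsNontrivial.{u}) {A C : L.Substructure P}
    (h : V.IsFreeProduct A C) {x : ι → A} {y : κ → C} (hx : V.FreelyGenerates x)
    (hy : V.FreelyGenerates y) :
    V.FreelyGenerates (Sum.elim (fun i => (x i : P)) fun k => (y k : P)) := by
  refine .of_existsUnique_extend (e := A.subtype.toHom) hV hx h.1 fun D _ hD f v => ?_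
  obtain ⟨g, hg⟩ := hy.exists_hom hD v
  obtain ⟨k, ⟨hkA, hkC⟩, hu⟩ := h.2 D hD f g
  refine ⟨k, ⟨hkA, fun i => (hkC _).trans (hg i)⟩, fun k' hk' => hu k' ⟨hk'.1, ?_⟩⟩
  have hk'C : k'.comp C.subtype.toHom = g :=
    hy.hom_ext hD fun i => (hk'.2 i).trans (hg i).symm
  exact DFunLike.congr_fun hk'C

theorem FreeFactor.exists_extension (hV : V.IsNontrivial.{u}) {A : L.Substructure P}
    (h : V.FreeFactor A) {x : ι → A} (hx : V.FreelyGenerates x) :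
    ∃ (κ : Type u) (y : κ → P), V.FreelyGenerates (Sum.elim (fun i => (x i : P)) y) := by
  obtain ⟨-, -, C, ⟨κ, y, hy⟩, hAC⟩ := h
  exact ⟨κ, _, hAC.freelyGenerates hV hx hy⟩

variable [L.IsAlgebraic]

namespace FreelyGenerates

variable {x : ι → M}

theorem exists_equiv {y : ι → N} (hx : V.FreelyGenerates x) (hy : V.FreelyGenerates y) :
    ∃ φ : M ≃[L] N, ∀ i, φ (x i) = y i := by
  obtain ⟨f, hf⟩ := hx.exists_hom hy.mem y
  obtain ⟨g, hg⟩ := hy.exists_hom hx.mem x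
  have hgf : g.comp f = Hom.id L M := hx.hom_ext hx.mem fun i => by simp [hf, hg]
  have hfg : f.comp g = Hom.id L N := hy.hom_ext hy.mem fun i => by simp [hf, hg]
  exact ⟨⟨⟨f, g, DFunLike.congr_fun hgf, DFunLike.congr_fun hfg⟩, fun h z => f.map_fun h z,
    fun r => isEmptyElim r⟩, hf⟩

theorem of_indep (hV : V.IsNontrivial.{u}) (hM : V.Mem M) (hx : V.Indep x)
    (hspan : ∀ m, ∃ t : L.Term ι, t.realize x = m) : V.FreelyGenerates x := by
  refine .of_lift hV hM fun D _ hD v => ?_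
  choose t ht using hspan
  refine ⟨⟨fun m => (t m).realize v, fun f y => ?_, fun r => isEmptyElim r⟩, fun i => ?_,
    fun g hg => ?_⟩
  · exact hx (t (Structure.funMap f y)) (.func f fun i => t (y i)) (by simp [ht]) D hD v
  · exact hx (t (x i)) (.var i) (ht _) D hD v
  · obtain rfl : g ∘ x = v := funext hg
    ext m
    calc g m = g ((t m).realize x) := by rw [ht]
      _ = (t m).realize (g ∘ x) := (HomClass.realize_term g).symm

end FreelyGenerates

theorem Indep.freelyGenerates_toClosureRange (hV : V.IsNontrivial.{u}) (hM : V.Mem M)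
    {x : ι → M} (hx : V.Indep x) : V.FreelyGenerates (toClosureRange L x) := by
  refine .of_indep hV (hM.substructure _) (hx.of_comp_hom (Substructure.subtype _).toHom) ?_
  rintro ⟨m, hm⟩
  obtain ⟨t, rfl⟩ := exists_realize_eq_of_mem_closure_range hm
  exact ⟨t, Subtype.ext (HomClass.realize_term (Substructure.subtype _)).symm⟩

namespace FreelyGenerates

variable {x : ι → M} {y : κ → N}

theorem isFreeProduct_closure (hV : V.IsNontrivial.{u}) {x : ι → P} {y : κ → P}
    (h : V.FreelyGenerates (Sum.elim x y)) :
    V.IsFreeProduct (Substructure.closure L (Set.range x))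
      (Substructure.closure L (Set.range y)) := by
  have hx := (h.indep.comp_injective Sum.inl_injective).freelyGenerates_toClosureRange hV h.mem
  have hy := (h.indep.comp_injective Sum.inr_injective).freelyGenerates_toClosureRange hV h.mem
  refine ⟨h.mem, fun D _ hD f g => ?_⟩
  obtain ⟨k, ⟨hkf, hkg⟩, hu⟩ := hx.existsUnique_extend (e := (Substructure.subtype _).toHom) h hD f
    (g ∘ toClosureRange L y)
  have hkg' : k.comp (Substructure.subtype _).toHom = g := hy.hom_ext hD hkg
  exact ⟨k, ⟨hkf, DFunLike.congr_fun hkg'⟩, fun k' hk' =>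
    hu k' ⟨hk'.1, fun i => hk'.2 (toClosureRange L y i)⟩⟩

theorem freeFactor_closure_range (hV : V.IsNontrivial.{u}) {x : ι → P} {y : κ → P}
    (h : V.FreelyGenerates (Sum.elim x y)) :
    V.FreeFactor (Substructure.closure L (Set.range x)) := by
  have hx := (h.indep.comp_injective Sum.inl_injective).freelyGenerates_toClosureRange hV h.mem
  have hy := (h.indep.comp_injective Sum.inr_injective).freelyGenerates_toClosureRange hV h.mem
  exact ⟨hx.isFree, h.isFree, _, hy.isFree, h.isFreeProduct_closure hV⟩

theorem freeFactor_closure (hV : V.IsNontrivial.{u}) (hx : V.FreelyGenerates x) {S : Set M}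
    (hS : S ⊆ Set.range x) : V.FreeFactor (Substructure.closure L S) := by
  classical
  obtain ⟨I, rfl⟩ := Set.subset_range_iff_exists_image_eq.1 hS
  rw [Set.image_eq_range]
  refine freeFactor_closure_range (y := fun i : ↥Iᶜ => x i) hV
    (hx.reindex (Equiv.Set.sumCompl I) ?_)
  rintro (i | i) <;> rfl

theorem exists_embedding_of_indep (hV : V.IsNontrivial.{u}) (hx : V.FreelyGenerates x)
    (hN : V.Mem N) {z : ι → N} (hz : V.Indep z) : ∃ f : M ↪[L] N, ∀ i, f (x i) = z i := by
  obtain ⟨φ, hφ⟩ := hx.exists_equiv (hz.freelyGenerates_toClosureRange hV hN)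
  exact ⟨(Substructure.subtype _).comp φ.toEmbedding, fun i => congrArg Subtype.val (hφ i)⟩

theorem exists_embedding (hV : V.IsNontrivial.{u}) (hx : V.FreelyGenerates x)
    (hy : V.FreelyGenerates y) {σ : ι → κ} (hσ : Function.Injective σ) :
    ∃ f : M ↪[L] N, (∀ i, f (x i) = y (σ i)) ∧ V.FreeFactor f.toHom.range := by
  obtain ⟨f, hf⟩ := hx.exists_embedding_of_indep hV hy.mem (hy.indep.comp_injective hσ)
  refine ⟨f, hf, ?_⟩
  rw [← hx.closure_range_comp]
  refine hy.freeFactor_closure hV ?_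
  rintro _ ⟨i, rfl⟩
  exact ⟨σ i, (hf i).symm⟩

end FreelyGenerates

theorem FreeFactor.map_equiv (hV : V.IsNontrivial.{u}) {A : L.Substructure N}
    (h : V.FreeFactor A) (φ : N ≃[L] P) : V.FreeFactor (A.map φ.toHom) := by
  obtain ⟨ι, x, hx⟩ := h.1
  obtain ⟨κ, y, hy⟩ := h.exists_extension hV hx
  rw [← hx.closure_range_coe, Substructure.map_closure, ← Set.range_comp]
  refine (hy.map_equiv φ).freeFactor_closure hV ?_
  rintro _ ⟨i, rfl⟩
  exact ⟨Sum.inl i, rfl⟩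

/-- Terms are identified when the identity between them holds in the variety; the quotient is the
free algebra on `ι`. -/
def termSetoid (V : AlgVariety L) (ι : Type u) : Setoid (L.Term ι) where
  r s t := ∀ (D : Type u) [L.Structure D], V.Mem D → ∀ v : ι → D, s.realize v = t.realize v
  iseqv := ⟨fun _ _ _ _ _ => rfl, fun h D _ hD v => (h D hD v).symm,
    fun h h' D _ hD v => (h D hD v).trans (h' D hD v)⟩

instance (V : AlgVariety L) (ι : Type u) : L.Prestructure (V.termSetoid ι) where
  toStructure := ⟨Term.func, fun r => isEmptyElim r⟩
  fun_equiv _ _ h D _ hD v := congrArg (Structure.funMap _) (funext fun i => h i D hD v)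
  rel_equiv {_ r} := isEmptyElim r

theorem realize_termSetoid_mk {ι : Type u} (t : L.Term κ) (v : κ → L.Term ι) :
    t.realize (fun k => (⟦v k⟧ : Quotient (V.termSetoid ι))) = ⟦t.subst v⟧ := by
  rw [Term.realize_quotient_mk']
  congr 1
  induction t with
  | var k => rfl
  | func f ts ih => exact congrArg (Term.func f) (funext ih)

theorem freelyGenerates_termSetoid_var (hV : V.IsNontrivial.{u}) (ι : Type u) :
    V.FreelyGenerates fun i : ι => (⟦.var i⟧ : Quotient (V.termSetoid ι)) := by
  refine .of_indep hV (fun e he v => ?_) (fun s t hst D _ hD v => ?_) fun m => ?_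
  · obtain ⟨w, rfl⟩ : ∃ w : ℕ → L.Term ι, (fun k => ⟦w k⟧) = v :=
      ⟨fun k => (v k).out, funext fun k => (v k).out_eq⟩
    rw [realize_termSetoid_mk, realize_termSetoid_mk]
    refine Quotient.sound fun D _ hD v => ?_
    rw [Term.realize_subst, Term.realize_subst]
    exact hD e he _
  · rw [realize_termSetoid_mk, realize_termSetoid_mk] at hst
    simpa only [Term.realize_subst, Term.realize_var] using Quotient.exact hst D hD v
  · obtain ⟨t, rfl⟩ := Quotient.exists_rep m
    refine ⟨t, (realize_termSetoid_mk t _).trans (Quotient.sound fun D _ _ v => ?_)⟩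
    simp only [Term.realize_subst, Term.realize_var]

theorem exists_freelyGenerates (hV : V.IsNontrivial.{u}) (ι : Type*) [Small.{u} ι] :
    ∃ (F : Type u) (_ : L.Structure F) (x : ι → F), V.FreelyGenerates x :=
  ⟨Quotient (V.termSetoid (Shrink.{u} ι)), _, _,
    (freelyGenerates_termSetoid_var hV _).reindex (equivShrink ι) fun _ => rfl⟩

theorem FreelyGenerates.exists_extension (hV : V.IsNontrivial.{u}) {b : ι → M}
    (hb : V.FreelyGenerates b) (κ : Type*) [Small.{u} κ] :
    ∃ (P : Type u) (_ : L.Structure P) (e : M ↪[L] P) (d : κ → P),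
      V.FreelyGenerates (Sum.elim (e ∘ b) d) := by
  have : Small.{u} ι := small_of_injective hb.injective
  obtain ⟨P, _, z, hz⟩ := exists_freelyGenerates hV (ι ⊕ κ)
  obtain ⟨e, he⟩ := hb.exists_embedding_of_indep hV hz.mem
    (hz.indep.comp_injective Sum.inl_injective)
  refine ⟨P, _, e, z ∘ Sum.inr, hz.reindex (.refl _) ?_⟩
  rintro (i | k)
  · exact he i
  · rfl

end AlgVariety

/-! ### Quantifier-free definable closure -/

section QFDcl

variable {L : FirstOrder.Language.{0, 0}} {M N : Type u} [L.Structure M] [L.Structure N]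

theorem QFDefinableOver.mono {S T : Set M} (h : S ⊆ T) {d : M} (hd : QFDefinableOver L S d) :
    QFDefinableOver L T d := by
  obtain ⟨φ, hφ, hd⟩ := hd
  refine ⟨φ.relabel (Sum.map (Set.inclusion h) id), hφ.relabel _, fun x => ?_⟩
  rw [Formula.realize_relabel, Sum.elim_comp_map, ← hd]
  rfl

theorem QFDefinableOver.map_equiv {T : Set N} (φ : M ≃[L] N) {d : M}
    (hd : QFDefinableOver L (φ ⁻¹' T) d) : QFDefinableOver L T (φ d) := by
  obtain ⟨ψ, hψ, hd⟩ := hd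
  refine ⟨ψ.relabel (Sum.map (T.restrictPreimage φ) id), hψ.relabel _, fun x => ?_⟩
  obtain ⟨x, rfl⟩ := φ.surjective x
  rw [Formula.realize_relabel, Sum.elim_comp_map, φ.injective.eq_iff, ← hd,
    ← StrongHomClass.realize_formula φ ψ, Sum.comp_elim]
  rfl

theorem subset_qfDcl (S : Set M) : S ⊆ qfDcl L S :=
  Set.subset_sInter fun _ hT => hT.1

theorem qfDcl_subset {S T : Set M} (h : S ⊆ T) (hT : ∀ d, QFDefinableOver L T d → d ∈ T) :
    qfDcl L S ⊆ T :=
  Set.sInter_subset_of_mem ⟨h, hT⟩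

theorem mem_qfDcl_of_definable {S : Set M} {d : M} (hd : QFDefinableOver L (qfDcl L S) d) :
    d ∈ qfDcl L S :=
  Set.mem_sInter.2 fun _ hT => hT.2 d (hd.mono (qfDcl_subset hT.1 hT.2))

theorem qfDcl_subset_qfDcl {S T : Set M} (h : S ⊆ qfDcl L T) : qfDcl L S ⊆ qfDcl L T :=
  qfDcl_subset h fun _ => mem_qfDcl_of_definable

theorem image_qfDcl_subset (φ : M ≃[L] N) (S : Set M) : φ '' qfDcl L S ⊆ qfDcl L (φ '' S) :=
  Set.image_subset_iff.2 (qfDcl_subset (Set.image_subset_iff.1 (subset_qfDcl _))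
    fun _ hd => mem_qfDcl_of_definable (hd.map_equiv φ))

theorem QFDefinableOver.funMap {n : ℕ} (f : L.Functions n) {S : Set M} {y : Fin n → M}
    (hy : ∀ i, y i ∈ S) : QFDefinableOver L S (Structure.funMap f y) :=
  ⟨(Term.var (Sum.inr ())).equal (.func f fun i => .var (Sum.inl ⟨y i, hy i⟩)),
    (BoundedFormula.IsAtomic.equal _ _).isQF, fun x => by simp [Formula.realize_equal]⟩

theorem closure_subset_qfDcl (S : Set M) : (Substructure.closure L S : Set M) ⊆ qfDcl L S := by
  let A : L.Substructure M :=
    ⟨qfDcl L S, fun f _ hy => mem_qfDcl_of_definable (QFDefinableOver.funMap f hy)⟩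
  exact (Substructure.closure_le (S := A)).2 (subset_qfDcl S)

end QFDcl

/-! ### RCP pairs -/

namespace AlgVariety

variable {L : FirstOrder.Language.{0, 0}} {V : AlgVariety L}
  {M B N P : Type u} [L.Structure M] [L.Structure B] [L.Structure N] [L.Structure P]

theorem FreelyGenerates.mk_le {ι : Type u} {x : ι → M} (hx : V.FreelyGenerates x)
    {lam : Cardinal.{u}} (hlam : ℵ₀ ≤ lam) (hL : Cardinal.lift.{u} L.card ≤ lam)
    (hι : #ι ≤ lam) : #M ≤ lam := by
  have hcl := Substructure.lift_card_closure_le (L := L) (s := Set.range x)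
  have hfun : Cardinal.lift.{u} #(Σ n, L.Functions n) ≤ lam :=
    (Cardinal.lift_le.2 (by simp [Language.card, Language.Symbols])).trans hL
  rw [hx.closure_range, Cardinal.lift_uzero, Cardinal.lift_uzero] at hcl
  calc #M = #(⊤ : L.Substructure M) := (Cardinal.mk_univ).symm
    _ ≤ _ := hcl
    _ ≤ lam := max_le hlam (Cardinal.add_le_of_le hlam (Cardinal.mk_range_le.trans hι) hfun)

theorem Indep.sumElim_of_forall_Iic {κ : Type*} {z : ℕ → M} {d : κ → M}
    (h : ∀ n : ℕ, V.Indep (Sum.elim (fun i : Set.Iic n => z i) d)) : V.Indep (Sum.elim z d) := by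
  refine .of_forall_finset fun S => ?_
  obtain ⟨n, hn⟩ := S.toLeft.bddAbove
  let σ : S → Set.Iic n ⊕ κ
    | ⟨.inl i, hi⟩ => .inl ⟨i, hn (Finset.mem_toLeft.2 hi)⟩
    | ⟨.inr k, _⟩ => .inr k
  have hσ : Function.Injective σ := by
    rintro ⟨i | k, hi⟩ ⟨j | l, hj⟩ hij <;> simp_all [σ, Subtype.ext_iff]
  convert (h n).comp_injective hσ using 1
  funext i
  rcases i with ⟨i | k, hi⟩ <;> rfl

namespace IsRCPPair

variable {A : L.Substructure B} {a : ℕ → A} {b : ℕ → B}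

theorem isNontrivial (h : V.IsRCPPair A a b) : V.IsNontrivial.{u} := h.free_right.isNontrivial

theorem indep (h : V.IsRCPPair A a b) : V.Indep (fun i => (a i : B)) :=
  h.free_left.indep.map A.subtype.toHom A.subtype.injective

theorem closure_range_comp (h : V.IsRCPPair A a b) (e : B →[L] P) :
    Substructure.closure L (Set.range fun i => e (a i)) = A.map e := by
  have hrange := h.free_left.closure_range_comp (e.comp A.subtype.toHom)
  rwa [Hom.range_comp, Substructure.range_subtype] at hrange

theorem qfDcl_sumElim (h : V.IsRCPPair A a b) {κ : Type*} {e : B ↪[L] P} {d : κ → P}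
    (hP : V.FreelyGenerates (Sum.elim (e ∘ b) d))
    (hd : Set.range e ⊆ qfDcl L (e '' A ∪ {e (b 0)})) :
    qfDcl L ((Substructure.closure L (Set.range (Sum.elim (fun i => e (a i)) d)) : Set P) ∪
      {e (b 0)}) = Set.univ := by
  set A' := Substructure.closure L (Set.range (Sum.elim (fun i => e (a i)) d))
  have hAA' : e '' A ⊆ A' := by
    change ((A.map e.toHom : L.Substructure P) : Set P) ⊆ A'
    rw [← h.closure_range_comp]
    exact Substructure.closure_mono (Set.range_comp_subset_range Sum.inl (Sum.elim _ d))
  have hb : Set.range e ⊆ qfDcl L ((A' : Set P) ∪ {e (b 0)}) :=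
    hd.trans (qfDcl_subset_qfDcl ((Set.union_subset_union_left _ hAA').trans (subset_qfDcl _)))
  have hgen : Set.range (Sum.elim (e ∘ b) d) ⊆ qfDcl L ((A' : Set P) ∪ {e (b 0)}) := by
    rintro _ ⟨i | k, rfl⟩
    · exact hb ⟨b i, rfl⟩
    · exact subset_qfDcl _ (Or.inl (Substructure.subset_closure ⟨Sum.inr k, rfl⟩))
  refine Set.univ_subset_iff.1 (subset_trans ?_ (qfDcl_subset_qfDcl hgen))
  refine subset_trans ?_ (closure_subset_qfDcl _)
  rw [hP.closure_range]
  exact fun _ _ => Substructure.mem_top _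

variable [L.IsAlgebraic]

theorem exists_extension (h : V.IsRCPPair A a b) (n : ℕ) : ∃ (κ : Type u) (w : κ → B),
    V.FreelyGenerates (Sum.elim (fun i : Set.Iic n => (a i : B)) w) := by
  have hff := h.freeFactor n
  rw [Set.image_eq_range] at hff
  exact hff.exists_extension h.isNontrivial
    ((h.indep.comp_injective Subtype.val_injective).freelyGenerates_toClosureRange
      h.isNontrivial h.free_right.mem)

theorem indep_sumElim (h : V.IsRCPPair A a b) {κ : Type*} {e : B →[L] P} {d : κ → P}
    (hP : V.FreelyGenerates (Sum.elim (e ∘ b) d)) :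
    V.Indep (Sum.elim (fun i => e (a i)) d) := by
  refine .sumElim_of_forall_Iic fun n => ?_
  obtain ⟨κ', w, hw⟩ := h.exists_extension n
  have hind := (hP.exchange h.isNontrivial h.free_right hw).indep.comp_injective
    (Sum.map_injective.2 ⟨Sum.inl_injective (β := κ'), Function.injective_id (α := κ)⟩)
  rwa [Sum.elim_comp_map] at hind

theorem not_freelyGenerates (h : V.IsRCPPair A a b) {κ κ' : Type*} {e : B ↪[L] P} {d : κ → P}
    (hP : V.FreelyGenerates (Sum.elim (e ∘ b) d)) {w : κ' → P} :
    ¬ V.FreelyGenerates (Sum.elim (fun i => e (a i)) w) := by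
  intro hw
  have hfree : V.IsFree (Substructure.closure L (Set.range d)) :=
    ((hP.indep.comp_injective Sum.inr_injective).freelyGenerates_toClosureRange
      h.isNontrivial hP.mem).isFree
  have hprod := hP.isFreeProduct_closure h.isNontrivial
  rw [show Substructure.closure L (Set.range (e ∘ b)) = e.toHom.range from
    h.free_right.closure_range_comp e.toHom] at hprod
  refine h.not_freeFactor P e _ hfree hprod ?_
  rw [← h.closure_range_comp]
  exact hw.freeFactor_closure_range h.isNontrivial

theorem map_equiv (h : V.IsRCPPair A a b) (φ : B ≃[L] N) :
    V.IsRCPPair (A.map φ.toHom) (φ.toEmbedding.substructureEquivMap A ∘ a) (φ ∘ b) where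
  free_left := h.free_left.map_equiv _
  free_right := h.free_right.map_equiv φ
  freeFactor i := by
    have hff := (h.freeFactor i).map_equiv h.isNontrivial φ
    rwa [Substructure.map_closure, Set.image_image] at hff
  not_freeFactor P _ e C hC hP := by
    have hrange : (e.comp φ.toEmbedding).toHom.range = e.toHom.range :=
      SetLike.coe_injective (φ.surjective.range_comp e)
    rw [Substructure.map_map]
    exact h.not_freeFactor P (e.comp φ.toEmbedding) C hC (hrange ▸ hP)
  qfDcl_eq := by
    have himage := image_qfDcl_subset φ ((A : Set B) ∪ {b 0})
    rw [h.qfDcl_eq, Set.image_univ, φ.surjective.range_eq, Set.image_union,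
      Set.image_singleton] at himage
    exact Set.univ_subset_iff.1 himage

section Extend

variable {κ : Type*} {e : B ↪[L] P} {d : κ → P}

theorem freeFactor_sumElim (h : V.IsRCPPair A a b) (hP : V.FreelyGenerates (Sum.elim (e ∘ b) d))
    {S : Set (ℕ ⊕ κ)} (hS : (Sum.inl ⁻¹' S).Finite) :
    V.FreeFactor (Substructure.closure L (Sum.elim (fun i => e (a i)) d '' S)) := by
  obtain ⟨n, hn⟩ := hS.bddAbove
  obtain ⟨κ', w, hw⟩ := h.exists_extension n
  refine (hP.exchange (e := e.toHom) h.isNontrivial h.free_right hw).freeFactor_closure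
    h.isNontrivial ?_
  rintro _ ⟨i | k, hi, rfl⟩
  · exact ⟨Sum.inl (Sum.inl ⟨i, hn hi⟩), rfl⟩
  · exact ⟨Sum.inr k, rfl⟩

theorem not_freeFactor_sumElim (h : V.IsRCPPair A a b)
    (hP : V.FreelyGenerates (Sum.elim (e ∘ b) d)) {Q : Type u} [L.Structure Q] (f : P ↪[L] Q)
    {C : L.Substructure Q} (hC : V.IsFree C) (hQ : V.IsFreeProduct f.toHom.range C) :
    ¬ V.FreeFactor
      ((Substructure.closure L (Set.range (Sum.elim (fun i => e (a i)) d))).map f.toHom) := by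
  intro hA
  have hind := h.indep_sumElim (e := e.toHom) hP
  obtain ⟨_, y, hy⟩ := hC
  have hQfree := hQ.freelyGenerates h.isNontrivial (hP.map_equiv f.equivRange) hy
  obtain ⟨_, w, hw⟩ := hA.exists_extension h.isNontrivial
    ((hind.freelyGenerates_toClosureRange h.isNontrivial hP.mem).map_equiv
      (f.substructureEquivMap _))
  refine h.not_freelyGenerates (e := f.comp e) (d := Sum.elim (f ∘ d) (fun k => (y k : Q)))
    (w := Sum.elim (f ∘ d) w) (hQfree.reindex (Equiv.sumAssoc _ _ _).symm ?_)
    (hw.reindex (Equiv.sumAssoc _ _ _).symm ?_)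
  all_goals rintro (i | i | i) <;> rfl

theorem extend (h : V.IsRCPPair A a b) (hP : V.FreelyGenerates (Sum.elim (e ∘ b) d))
    (hd : Set.range e ⊆ qfDcl L (e '' A ∪ {e (b 0)})) {σ : ℕ ≃ ℕ ⊕ κ} (hσ : σ 0 = Sum.inl 0) :
    V.IsRCPPair (Substructure.closure L (Set.range (Sum.elim (fun i => e (a i)) d)))
      (toClosureRange L (Sum.elim (fun i => e (a i)) d) ∘ σ) (Sum.elim (e ∘ b) d ∘ σ) where
  free_left := ((h.indep_sumElim (e := e.toHom) hP).freelyGenerates_toClosureRange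
    h.isNontrivial hP.mem).reindex σ fun _ => rfl
  free_right := hP.reindex σ fun _ => rfl
  freeFactor i := by
    rw [show (fun j => ((toClosureRange L (Sum.elim (fun i => e (a i)) d) ∘ σ) j : P)) =
      Sum.elim (fun i => e (a i)) d ∘ σ from rfl, Set.image_comp]
    refine h.freeFactor_sumElim hP (((Set.finite_Iic i).image σ).preimage ?_)
    exact Sum.inl_injective.injOn
  not_freeFactor Q _ f _ hC hQ := h.not_freeFactor_sumElim hP f hC hQ
  qfDcl_eq := by
    rw [Function.comp_apply, hσ]
    exact h.qfDcl_sumElim hP hd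

end Extend

end IsRCPPair

end AlgVariety

/-! ### Abstract elementary classes -/

namespace StrongClass

variable {L : FirstOrder.Language.{0, 0}} {K : StrongClass.{u} L} {M N P : Type u}
  [L.Structure M] [L.Structure N] [L.Structure P]

theorem IsAEC.strong_comp (hK : K.IsAEC) {f : M ↪[L] N} {g : N ↪[L] P}
    (hf : K.IsStrongEmbedding f) (hg : K.IsStrongEmbedding g) :
    K.IsStrongEmbedding (g.comp f) := by
  refine hK.trans _ g.toHom.range ⟨?_, ?_⟩ hg
  · rintro _ ⟨m, rfl⟩
    exact ⟨f m, rfl⟩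
  · convert hK.strong_equiv g.equivRange _ hf using 1
    ext ⟨_, m, rfl⟩
    constructor
    · rintro ⟨y, hy⟩
      exact ⟨f y, ⟨y, rfl⟩, Subtype.ext hy⟩
    · rintro ⟨_, ⟨y, rfl⟩, hy⟩
      exact ⟨y, congrArg Subtype.val hy⟩

theorem IsAEC.strong_refl (hK : K.IsAEC) (hM : K.Mem M) :
    K.IsStrongEmbedding (Embedding.refl L M) := by
  rw [IsStrongEmbedding, Embedding.refl_toHom, Hom.range_id]
  exact hK.refl hM

theorem IsAEC.strong_equiv_comp (hK : K.IsAEC) {f : M ↪[L] N} (hf : K.IsStrongEmbedding f)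
    (φ : N ≃[L] P) : K.IsStrongEmbedding (φ.toEmbedding.comp f) := by
  have hrange : (φ.toEmbedding.comp f).toHom.range = f.toHom.range.map φ.toHom :=
    Hom.range_comp f.toHom φ.toHom
  rw [IsStrongEmbedding, hrange]
  exact hK.strong_equiv φ _ hf

theorem IsAEC.strong_iSup_nat (hK : K.IsAEC) {A : ℕ → L.Substructure M} (hmono : Monotone A)
    (hA : ∀ n, K.Strong (A n)) : K.Strong (⨆ n, A n) := by
  have hunion := (hK.chain (fun n : ULift.{u} ℕ => A n.down)
    (fun i j hij => hK.coherence _ _ (hA _) (hA _) (hmono hij)) fun i hi => ?_).2.2 fun i => hA _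
  · rwa [ULift.down_surjective.iSup_comp] at hunion
  · exact absurd (ULift.orderIso.toInitialSeg.map_isSuccLimit hi)
      Order.not_isSuccLimit_of_isSuccArchimedean

theorem sameGaloisType_equivalence (hap : K.AP) (hK : K.IsAEC) :
    Equivalence (K.SameGaloisType (A := M)) where
  refl p := by
    let := p.str
    exact ⟨p.N, p.str, Embedding.refl L p.N, Embedding.refl L p.N, p.mem, hK.strong_refl p.mem,
      hK.strong_refl p.mem, fun _ => rfl, rfl⟩
  symm := by
    rintro p q ⟨P, _, g, h, hP, hg, hh, hbase, hpt⟩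
    exact ⟨P, _, h, g, hP, hh, hg, fun x => (hbase x).symm, hpt.symm⟩
  trans := by
    rintro p q r ⟨P, _, g, h, hP, hg, hh, hbase, hpt⟩ ⟨P', _, g', h', hP', hg', hh', hbase', hpt'⟩
    let := p.str
    let := q.str
    let := r.str
    obtain ⟨Q, _, k, k', hQ, hk, hk', hkk⟩ := hap q.N P P' q.mem hP hP' h g' hh hg'
    refine ⟨Q, _, k.comp g, k'.comp h', hQ, hK.strong_comp hg hk, hK.strong_comp hh' hk',
      fun x => ?_, ?_⟩
    · rw [Embedding.comp_apply, Embedding.comp_apply, hbase, hkk, hbase']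
    · rw [Embedding.comp_apply, Embedding.comp_apply, hpt, hkk, hpt']

theorem sameOrbit_equivalence (A : L.Substructure M) : Equivalence (SameOrbit A) where
  refl _ := ⟨Language.Equiv.refl L M, fun _ _ => rfl, rfl⟩
  symm := by
    rintro a _ ⟨π, hπ, rfl⟩
    exact ⟨π.symm, fun x hx => π.injective (by simp [hπ x hx]), π.symm_apply_apply a⟩
  trans := by
    rintro a _ _ ⟨π, hπ, rfl⟩ ⟨π', hπ', rfl⟩
    exact ⟨π'.comp π, fun x hx => by simp [hπ x hx, hπ' x hx], rfl⟩

theorem IsMonster.exists_embedding (hK : K.IsAEC) {κ : Cardinal.{u}} (hP : K.IsMonster κ P)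
    {f : M ↪[L] P} (hf : K.IsStrongEmbedding f) (hM : #M < κ) {i : M ↪[L] N}
    (hi : K.IsStrongEmbedding i) (hN : K.Mem N) (hNκ : #N ≤ κ) :
    ∃ g : N ↪[L] P, K.IsStrongEmbedding g ∧ ∀ x, g (i x) = f x := by
  obtain ⟨u, hu⟩ := hP.universal N hN hNκ
  have card_range (f : M ↪[L] P) : #f.toHom.range < κ := by
    rwa [← f.equivRange.toEquiv.cardinal_eq]
  obtain ⟨π, hπ⟩ := hP.homogeneous _ _ (hK.strong_comp hi hu) hf (card_range _) (card_range _)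
    (f.equivRange.comp (u.comp i).equivRange.symm)
  refine ⟨π.toEmbedding.comp u, hK.strong_equiv_comp hu π, fun x => ?_⟩
  have hπx := hπ ((u.comp i).equivRange x)
  rwa [Language.Equiv.comp_apply, Language.Equiv.symm_apply_apply, Embedding.equivRange_apply,
    Embedding.equivRange_apply] at hπx

variable (K) in
/-- Some model of size `lam` carries more than `lam` Galois types, realized in strong extensions of
size at most `lam`. The bound on the extensions is what lets them embed into monster models. -/
def HasManyTypes (lam : Cardinal.{u}) : Prop :=
  ∃ (A : Type u) (_ : L.Structure A) (I : Type u) (q : I → K.PointedExt A), K.Mem A ∧ #A = lam ∧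
    lam < #I ∧ (∀ i, #(q i).N ≤ lam) ∧ ∀ i j, K.SameGaloisType (q i) (q j) → i = j

theorem HasManyTypes.not_stableIn {lam : Cardinal.{u}} (h : K.HasManyTypes lam) (hK : K.IsAEC)
    (hap : K.AP) : ¬ K.StableIn lam := by
  obtain ⟨A, _, I, q, hA, hcard, hI, -, hq⟩ := h
  have hinj : Function.Injective fun i => (Quot.mk _ (q i) : K.GaloisTypes A) := fun i j hij =>
    hq i j (((sameGaloisType_equivalence hap hK).quot_mk_eq_iff _ _).1 hij)
  intro hstable
  have hle := (lift_mk_le_lift_mk_of_injective hinj).trans (lift_le.2 (hstable A hA hcard))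
  rw [lift_lift] at hle
  exact hI.not_ge (lift_le.1 hle)

theorem HasManyTypes.exists_lt_mk_orbitTypes {lam κ : Cardinal.{u}} (h : K.HasManyTypes lam)
    (hK : K.IsAEC) (hκ : lam < κ) (hM : K.IsMonster κ M) :
    ∃ A : L.Substructure M, K.Strong A ∧ #A = lam ∧ lam < #(OrbitTypes A) := by
  obtain ⟨A, _, I, q, hA, hcard, hI, hqcard, hq⟩ := h
  let (i : I) : L.Structure (q i).N := (q i).str
  obtain ⟨f, hf⟩ := hM.universal A hA (hcard.trans_le hκ.le)
  choose g hg hgf using fun i => hM.exists_embedding hK hf (hcard.trans_lt hκ) (q i).strong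
    (q i).mem ((hqcard i).trans hκ.le)
  have hinj : Function.Injective fun i =>
      (Quot.mk _ (g i (q i).pt) : OrbitTypes f.toHom.range) := by
    intro i j hij
    obtain ⟨π, hπ, hπpt⟩ := ((sameOrbit_equivalence f.toHom.range).quot_mk_eq_iff _ _).1 hij
    refine hq i j ⟨M, _, π.toEmbedding.comp (g i), g j, hM.mem, hK.strong_equiv_comp (hg i) π,
      hg j, fun x => ?_, hπpt⟩
    exact ((congrArg π (hgf i x)).trans (hπ _ ⟨x, rfl⟩)).trans (hgf j x).symm
  exact ⟨f.toHom.range, hf, by rw [← f.equivRange.toEquiv.cardinal_eq, hcard],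
    hI.trans_le (mk_le_of_injective hinj)⟩

variable (K) in
/-- An AEC in the language of the variety `V` which contains the free algebras of infinite rank and
refines `≤∗^ff` on them: an AEC-covering without the amalgamation and joint embedding properties. -/
structure IsPrecovering (V : AlgVariety L) : Prop where
  mem_of_isFreeInf : ∀ (M : Type u) [L.Structure M], V.IsFreeInf M → K.Mem M
  isAEC : K.IsAEC
  strong_of_freeFactor : ∀ (B : Type u) [L.Structure B] (A : L.Substructure B),
    K.Mem A → K.Mem B → V.FreeFactor A → K.Strong A

variable (K) in
/-- Condition (ii) of strong enough coverings: for an RCP pair `A ≤ B`, the closure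
`dcl^qf(A b₀)` does not grow when passing from `B` to a strong extension. -/
def QFDclAbsolute (V : AlgVariety L) : Prop :=
  ∀ (M : Type u) [L.Structure M] (B : L.Substructure M) (A : L.Substructure B)
    (a : ℕ → A) (b : ℕ → B), V.IsRCPPair A a b → K.Strong B →
    Subtype.val '' qfDcl L ((A : Set B) ∪ {b 0}) =
      qfDcl L ((Subtype.val '' (A : Set B)) ∪ {(b 0 : M)})

theorem IsPrecovering.isStrongEmbedding {V : AlgVariety L} (hK : K.IsPrecovering V)
    (hM : V.IsFreeInf M) (hN : V.IsFreeInf N) {f : M ↪[L] N} (hf : V.FreeFactor f.toHom.range) :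
    K.IsStrongEmbedding f :=
  hK.strong_of_freeFactor N _ (hK.isAEC.mem_equiv f.equivRange (hK.mem_of_isFreeInf M hM))
    (hK.mem_of_isFreeInf N hN) hf

end StrongClass

/-! ### Gluing along branches -/

namespace AlgVariety

variable {L : FirstOrder.Language.{0, 0}} [L.IsAlgebraic] {V : AlgVariety L} {K : StrongClass.{u} L}
  {B F M N N' P : Type u} [L.Structure B] [L.Structure F] [L.Structure M] [L.Structure N]
  [L.Structure N'] [L.Structure P]

theorem FreelyGenerates.exists_embedding_over {ι κ κ' : Type*} {b : ι → B} {c : B ↪[L] P}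
    {d : κ → P} {e : B ↪[L] N} {y : κ' → N} (hV : V.IsNontrivial.{u}) (hb : V.FreelyGenerates b)
    (hP : V.FreelyGenerates (Sum.elim (c ∘ b) d)) (hN : V.FreelyGenerates (Sum.elim (e ∘ b) y))
    {σ : κ → κ'} (hσ : Function.Injective σ) :
    ∃ j : P ↪[L] N, (∀ m, j (c m) = e m) ∧ (∀ k, j (d k) = y (σ k)) ∧
      V.FreeFactor j.toHom.range := by
  obtain ⟨j, hj, hff⟩ := hP.exists_embedding hV hN
    (Sum.map_injective.2 ⟨Function.injective_id, hσ⟩)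
  have hjc : j.toHom.comp c.toHom = e.toHom := hb.hom_ext hN.mem fun i => hj (Sum.inl i)
  exact ⟨j, DFunLike.congr_fun hjc, fun k => hj (Sum.inr k), hff⟩

namespace IsRCPPair

variable {A : L.Substructure B} {a : ℕ → A} {b : ℕ → B}

/-- `A ∗ D` is the union of the chain `⟨a₀, …, aₙ⟩ ∗ D` of free factors of `B ∗ D`. -/
theorem strong_sumElim (h : V.IsRCPPair A a b) (hK : K.IsPrecovering V) {κ : Type*} [Infinite κ]
    {e : B ↪[L] P} {d : κ → P} (hP : V.FreelyGenerates (Sum.elim (e ∘ b) d)) :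
    K.Strong (Substructure.closure L (Set.range (Sum.elim (fun i => e (a i)) d))) := by
  let S (n : ℕ) : Set (ℕ ⊕ κ) := Sum.inl '' Set.Iic n ∪ Set.range Sum.inr
  have hmono : Monotone S := fun _ _ hnm =>
    Set.union_subset_union_left _ (Set.image_mono (Set.Iic_subset_Iic.2 hnm))
  have hunion : ⋃ n, S n = Set.univ :=
    Set.eq_univ_of_forall <| Sum.rec
      (fun i => Set.mem_iUnion.2 ⟨i, Or.inl ⟨i, Set.self_mem_Iic, rfl⟩⟩)
      fun k => Set.mem_iUnion.2 ⟨0, Or.inr ⟨k, rfl⟩⟩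
  rw [← Set.image_univ, ← hunion, Set.image_iUnion, Substructure.closure_iUnion]
  refine hK.isAEC.strong_iSup_nat
    (fun _ _ hnm => Substructure.closure_mono (Set.image_mono (hmono hnm))) fun n => ?_
  have hfinite : (Sum.inl ⁻¹' S n : Set ℕ).Finite := (Set.finite_Iic n).subset fun i hi => by
    simpa [S] using hi
  have : Infinite (S n) :=
    ((Set.infinite_range_of_injective Sum.inr_injective).mono Set.subset_union_right).to_subtype
  refine hK.strong_of_freeFactor P _ (hK.mem_of_isFreeInf _ ?_)
    (hK.mem_of_isFreeInf P hP.isFreeInf) (h.freeFactor_sumElim hP hfinite)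
  rw [Set.image_eq_range]
  exact (((h.indep_sumElim (e := e.toHom) hP).comp_injective
    Subtype.val_injective).freelyGenerates_toClosureRange h.isNontrivial hP.mem).isFreeInf

theorem range_eq_qfDcl (h : V.IsRCPPair A a b) (hdcl : K.QFDclAbsolute V) {f : B ↪[L] M}
    (hf : K.IsStrongEmbedding f) : Set.range f = qfDcl L (f '' A ∪ {f (b 0)}) := by
  have hpair := h.map_equiv f.equivRange
  have himage : Subtype.val '' (A.map f.equivRange.toHom : Set f.toHom.range) = f '' A :=
    Set.image_image _ _ _
  have heq := hdcl _ _ _ _ _ hpair hf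
  rw [hpair.qfDcl_eq, Set.image_univ, Subtype.range_coe, himage] at heq
  exact heq

theorem range_eq_qfDcl_sumElim (h : V.IsRCPPair A a b) (hK : K.IsPrecovering V)
    (hdcl : K.QFDclAbsolute V) {κ : Type*} [Countable κ] {e : B ↪[L] P} {d : κ → P}
    (hP : V.FreelyGenerates (Sum.elim (e ∘ b) d)) {f : P ↪[L] M} (hf : K.IsStrongEmbedding f) :
    Set.range f = qfDcl L (Substructure.closure L
      (Set.range (f ∘ Sum.elim (fun i => e (a i)) d)) ∪ {f (e (b 0))}) := by
  have he : K.IsStrongEmbedding e := by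
    refine hK.isStrongEmbedding h.free_right.isFreeInf hP.isFreeInf ?_
    rw [← h.free_right.closure_range_comp]
    exact hP.freeFactor_closure_range h.isNontrivial
  obtain ⟨σ, hσ⟩ : ∃ σ : ℕ ≃ ℕ ⊕ κ, σ 0 = Sum.inl 0 := by
    obtain ⟨σ⟩ := nonempty_equiv_of_countable (α := ℕ) (β := ℕ ⊕ κ)
    classical
    exact ⟨σ.trans (Equiv.swap (σ 0) (Sum.inl 0)), Equiv.swap_apply_left _ _⟩
  have hrange := (h.extend hP (h.range_eq_qfDcl hdcl he).subset hσ).range_eq_qfDcl hdcl hf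
  have himage (S : Set P) : f '' Substructure.closure L S = Substructure.closure L (f '' S) :=
    congrArg SetLike.coe (Substructure.map_closure f.toHom S)
  rwa [himage, ← Set.range_comp, Function.comp_apply, hσ] at hrange

section Swap

variable {n : ℕ} {e : B ↪[L] P} {d : ↥(Set.Iic n)ᶜ → P}

/-- `a₀, …, aₙ` extends by some `w` to a basis of `B`, and hence of `P = B ∗ D` together with `d`.
As `α` maps `a` to `a₀, …, aₙ, d`, its inverse turns this basis into `a, α⁻¹ w`. -/
theorem not_forall_equiv_apply_eq (h : V.IsRCPPair A a b)
    (hP : V.FreelyGenerates (Sum.elim (e ∘ b) d)) (α : P ≃[L] P)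
    (hfix : ∀ k ≤ n, α (e (a k)) = e (a k)) : ¬ ∀ k : ↥(Set.Iic n)ᶜ, α (e (a k)) = d k := by
  intro hmove
  obtain ⟨κ, w, hw⟩ := h.exists_extension n
  have hbasis := hP.exchange (e := e.toHom) h.isNontrivial h.free_right hw
  let σ : (Set.Iic n ⊕ κ) ⊕ ↥(Set.Iic n)ᶜ ≃ ℕ ⊕ κ :=
    (Equiv.sumAssoc _ _ _).trans <| ((Equiv.refl _).sumCongr (Equiv.sumComm _ _)).trans <|
      (Equiv.sumAssoc _ _ _).symm.trans <| (Equiv.Set.sumCompl (Set.Iic n)).sumCongr (Equiv.refl κ)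
  have hαbasis : V.FreelyGenerates (Sum.elim (fun k => α (e (a k))) (e ∘ w)) := by
    refine hbasis.reindex σ.symm (σ.surjective.forall.2 fun k => ?_)
    rw [σ.symm_apply_apply]
    rcases k with (k | k) | k
    · exact hfix k k.2
    · rfl
    · exact hmove k
  refine h.not_freelyGenerates hP (w := α.symm ∘ e ∘ w)
    ((hαbasis.map_equiv α.symm).reindex (.refl _) ?_)
  rintro (k | k)
  · exact (α.symm_apply_apply _).symm
  · rfl

theorem ne_of_swap (h : V.IsRCPPair A a b) (hK : K.IsPrecovering V) (hdcl : K.QFDclAbsolute V)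
    (hP : V.FreelyGenerates (Sum.elim (e ∘ b) d)) {f g : P ↪[L] M}
    (hf : K.IsStrongEmbedding f) (hg : K.IsStrongEmbedding g)
    (hfix : ∀ k ≤ n, f (e (a k)) = g (e (a k)))
    (hswap : ∀ k : ↥(Set.Iic n)ᶜ, f (e (a k)) = g (d k))
    (hswap' : ∀ k : ↥(Set.Iic n)ᶜ, f (d k) = g (e (a k))) : f (e (b 0)) ≠ g (e (b 0)) := by
  intro hpt
  have range_subset {f g : P ↪[L] M} (hfix : ∀ k ≤ n, f (e (a k)) = g (e (a k)))
      (hswap : ∀ k : ↥(Set.Iic n)ᶜ, f (e (a k)) = g (d k))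
      (hswap' : ∀ k : ↥(Set.Iic n)ᶜ, f (d k) = g (e (a k))) :
      Set.range (f ∘ Sum.elim (fun i => e (a i)) d) ⊆
        Set.range (g ∘ Sum.elim (fun i => e (a i)) d) := by
    rintro _ ⟨k | k, rfl⟩
    · by_cases hk : k ≤ n
      · exact ⟨Sum.inl k, (hfix k hk).symm⟩
      · exact ⟨Sum.inr ⟨k, hk⟩, (hswap ⟨k, hk⟩).symm⟩
    · exact ⟨Sum.inl k, (hswap' k).symm⟩
  have hrange : Set.range f = Set.range g := by
    rw [h.range_eq_qfDcl_sumElim hK hdcl hP hf, h.range_eq_qfDcl_sumElim hK hdcl hP hg, hpt,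
      (range_subset hfix hswap hswap').antisymm (range_subset (fun k hk => (hfix k hk).symm)
        (fun k => (hswap' k).symm) fun k => (hswap k).symm)]
  obtain ⟨α, hα⟩ := exists_equiv_of_range_eq f g (SetLike.coe_injective hrange)
  exact h.not_forall_equiv_apply_eq hP α (fun k hk => g.injective ((hα _).trans (hfix k hk)))
    fun k => g.injective ((hα _).trans (hswap k))

end Swap

end IsRCPPair

/-- `N`, with the embeddings `e` of `B` and `i` of `F`, is the free product of `B` and the algebra
`F` freely generated by `x` with amalgamation of `a k` and `x (p k)`: a pushout of `B` and `F` over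
`A = ⟨a k⟩`. The universal property is stated by saying that a basis of `B` together with the
generators of `F` off the sequence `p` is a basis of `N`. -/
structure IsAmalgamAlong (V : AlgVariety L) {A : L.Substructure B} (a : ℕ → A) (b : ℕ → B)
    {T : Type u} (x : T → F) (p : ℕ → T) (e : B ↪[L] N) (i : F ↪[L] N) : Prop where
  comm : ∀ k, i (x (p k)) = e (a k)
  free : V.FreelyGenerates (Sum.elim (e ∘ b) fun t : ↥(Set.range p)ᶜ => i (x t))

namespace IsRCPPair

variable {A : L.Substructure B} {a : ℕ → A} {b : ℕ → B} {T : Type u} {x : T → F} {p p' : ℕ → T}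

theorem exists_isAmalgamAlong (h : V.IsRCPPair A a b) (hK : K.IsPrecovering V)
    (hx : V.FreelyGenerates x) (hp : Function.Injective p) (hcompl : (Set.range p)ᶜ.Infinite)
    {lam : Cardinal.{u}} (hlam : ℵ₀ ≤ lam) (hL : Cardinal.lift.{u} L.card ≤ lam)
    (hT : #T ≤ lam) :
    ∃ (N : Type u) (_ : L.Structure N) (e : B ↪[L] N) (i : F ↪[L] N),
      V.IsAmalgamAlong a b x p e i ∧ K.IsStrongEmbedding i ∧ #N ≤ lam := by
  have := hcompl.to_subtype
  obtain ⟨N, _, e, d, hN⟩ := h.free_right.exists_extension h.isNontrivial ↥(Set.range p)ᶜ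
  classical
  let σ : ℕ ⊕ ↥(Set.range p)ᶜ ≃ T :=
    ((Equiv.ofInjective p hp).sumCongr (Equiv.refl _)).trans (Equiv.Set.sumCompl (Set.range p))
  have hxσ : V.FreelyGenerates (x ∘ σ) := hx.reindex σ fun _ => rfl
  obtain ⟨i, hi⟩ := hxσ.exists_embedding_of_indep h.isNontrivial hN.mem
    (h.indep_sumElim (e := e.toHom) hN)
  refine ⟨N, _, e, i, ⟨fun k => hi (Sum.inl k), ?_⟩, ?_,
    hN.mk_le hlam hL (σ.cardinal_eq.trans_le hT)⟩
  · rwa [show (fun t : ↥(Set.range p)ᶜ => i (x t)) = d from funext fun t => hi (Sum.inr t)]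
  · rw [StrongClass.IsStrongEmbedding, ← hxσ.closure_range_comp, Embedding.coe_toHom,
      show i ∘ x ∘ σ = Sum.elim (fun k => e (a k)) d from funext hi]
    exact h.strong_sumElim hK hN

theorem point_ne_of_branch (h : V.IsRCPPair A a b) (hK : K.IsPrecovering V)
    (hdcl : K.QFDclAbsolute V) (hp : Function.Injective p) (hp' : Function.Injective p') {n : ℕ}
    (heq : ∀ k ≤ n, p k = p' k) (hne : ∀ k, n < k → p k ∉ Set.range p')
    (hne' : ∀ k, n < k → p' k ∉ Set.range p) {e : B ↪[L] N} {i : F ↪[L] N}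
    (hN : V.IsAmalgamAlong a b x p e i) {e' : B ↪[L] N'} {i' : F ↪[L] N'}
    (hN' : V.IsAmalgamAlong a b x p' e' i') {g : N ↪[L] M} {g' : N' ↪[L] M}
    (hg : K.IsStrongEmbedding g) (hg' : K.IsStrongEmbedding g')
    (hgi : ∀ m, g (i m) = g' (i' m)) : g (e (b 0)) ≠ g' (e' (b 0)) := by
  obtain ⟨P, _, c, d, hP⟩ := h.free_right.exists_extension h.isNontrivial ↥(Set.Iic n)ᶜ
  have exists_strong_over {p q : ℕ → T} (hq : Function.Injective q)
      (hqp : ∀ k, n < k → q k ∉ Set.range p) {N : Type u} [L.Structure N] {e : B ↪[L] N}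
      {i : F ↪[L] N} (hN : V.IsAmalgamAlong a b x p e i) : ∃ j : P ↪[L] N,
      (∀ m, j (c m) = e m) ∧ (∀ k, j (d k) = i (x (q k))) ∧ K.IsStrongEmbedding j := by
    obtain ⟨j, hjc, hjd, hff⟩ := h.free_right.exists_embedding_over h.isNontrivial hP hN.free
      (σ := fun k => ⟨q k, hqp k (not_le.1 k.2)⟩)
      fun k l hkl => Subtype.ext (hq (congrArg Subtype.val hkl))
    exact ⟨j, hjc, hjd, hK.isStrongEmbedding hP.isFreeInf hN.free.isFreeInf hff⟩
  obtain ⟨j, hjc, hjd, hj⟩ := exists_strong_over hp' hne' hN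
  obtain ⟨j', hjc', hjd', hj'⟩ := exists_strong_over hp hne hN'
  have hswap := h.ne_of_swap hK hdcl hP (hK.isAEC.strong_comp hj hg)
    (hK.isAEC.strong_comp hj' hg')
  simp only [Embedding.comp_apply, hjc, hjc', hjd, hjd', ← hN.comm, ← hN'.comm, hgi,
    implies_true, forall_const] at hswap
  exact hswap fun k hk => by rw [heq k hk]

end IsRCPPair

end AlgVariety

section Branches

variable {Λ : Type*}

theorem injective_res (η : ℕ → Λ) : Function.Injective (PiNat.res η) :=
  Function.LeftInverse.injective (PiNat.res_length η)

theorem res_notMem_range {η ν : ℕ → Λ} {n k : ℕ} (h : η n ≠ ν n) (hk : n < k) :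
    PiNat.res η k ∉ Set.range (PiNat.res ν) := by
  rintro ⟨l, hl⟩
  obtain rfl : l = k := by simpa using congrArg List.length hl
  exact h (PiNat.res_eq_res.1 hl hk).symm

theorem infinite_compl_range_res [Nontrivial Λ] (η : ℕ → Λ) :
    (Set.range (PiNat.res η))ᶜ.Infinite := by
  obtain ⟨y, hy⟩ := exists_ne (η 0)
  exact Set.infinite_of_injective_forall_mem
    ((injective_res fun _ => y).comp Nat.succ_injective) fun k => res_notMem_range hy k.succ_pos

end Branches

theorem exists_lt_power_aleph0 (μ : Cardinal.{u}) :
    ∃ lam : Cardinal.{u}, μ ≤ lam ∧ ℵ₀ ≤ lam ∧ lam < lam ^ ℵ₀ := by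
  refine ⟨ℵ_ (μ.ord + Ordinal.omega0), ?_, aleph0_le_aleph _, ?_⟩
  · calc μ = μ.ord.card := (card_ord μ).symm
      _ ≤ (Ordinal.omega μ.ord).card :=
        Ordinal.card_le_card (Ordinal.isNormal_omega.strictMono.le_apply)
      _ = ℵ_ μ.ord := Ordinal.card_omega _
      _ ≤ ℵ_ (μ.ord + Ordinal.omega0) := aleph_le_aleph.2 (by simp)
  · have hcof := lt_power_cof_ord (aleph0_le_aleph (μ.ord + Ordinal.omega0))
    rwa [ord_aleph, Ordinal.cof_omega (Ordinal.isSuccLimit_add _ Ordinal.isSuccLimit_omega0),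
      Ordinal.cof_add _ Ordinal.omega0_ne_zero, Ordinal.cof_omega0] at hcof

theorem AlgVariety.RCP.hasManyTypes {L : FirstOrder.Language.{0, 0}} [L.IsAlgebraic]
    {V : AlgVariety L} (hV : AlgVariety.RCP.{u} V) {K : StrongClass.{u} L}
    (hK : K.IsPrecovering V) (hdcl : K.QFDclAbsolute V) {lam : Cardinal.{u}} (hlam : ℵ₀ ≤ lam)
    (hL : Cardinal.lift.{u} L.card ≤ lam) (hpow : lam < lam ^ ℵ₀) : K.HasManyTypes lam := by
  obtain ⟨B, _, A, a, b, h⟩ := hV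
  let Λ := lam.out
  have : Infinite Λ := infinite_iff.2 (by rwa [mk_out])
  have hT : #(List Λ) = lam := by rw [mk_list_eq_mk, mk_out]
  obtain ⟨F, _, x, hx⟩ := AlgVariety.exists_freelyGenerates h.isNontrivial (List Λ)
  choose N strN e i hN hi hcard using fun η : ℕ → Λ => h.exists_isAmalgamAlong hK hx
    (injective_res η) (infinite_compl_range_res η) hlam hL hT.le
  refine ⟨F, _, ℕ → Λ, fun η => ⟨N η, strN η, hK.mem_of_isFreeInf _ (hN η).free.isFreeInf, i η,
    hi η, e η (b 0)⟩, hK.mem_of_isFreeInf _ hx.isFreeInf, ?_, ?_, hcard, ?_⟩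
  · exact (hx.mk_le hlam hL hT.le).antisymm (hT ▸ mk_le_of_injective hx.injective)
  · simpa [Λ] using hpow
  · rintro η ν ⟨P, _, g, g', -, hg, hg', hbase, hpt⟩
    by_contra hne
    have hbranch := PiNat.apply_firstDiff_ne hne
    exact h.point_ne_of_branch hK hdcl (injective_res η) (injective_res ν)
      (fun k hk => PiNat.res_eq_res.2 fun m hm =>
        PiNat.apply_eq_of_lt_firstDiff (hm.trans_le hk))
      (fun k => res_notMem_range hbranch) (fun k => res_notMem_range hbranch.symm)
      (hN η) (hN ν) hg hg' hbase hpt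

end

theorem theorem1p5_general (L : FirstOrder.Language.{0, 0}) [L.IsAlgebraic]
    (V : AlgVariety L) (hV : AlgVariety.RCP.{u} V) (K : StrongClass.{u} L)
    (hK : K.IsPrecovering V) (hap : K.AP) (hdcl : K.QFDclAbsolute V) :
    ¬ K.Superstable ∧ ¬ K.MonsterSuperstable := by
  have exists_hasManyTypes (μ : Cardinal.{u}) : ∃ lam, μ ≤ lam ∧ K.HasManyTypes lam := by
    obtain ⟨lam, hμ, hlam, hpow⟩ := exists_lt_power_aleph0 (max μ (Cardinal.lift.{u} L.card))
    exact ⟨lam, (le_max_left _ _).trans hμ,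
      hV.hasManyTypes hK hdcl hlam ((le_max_right _ _).trans hμ) hpow⟩
  constructor
  · rintro ⟨μ, hstable⟩
    obtain ⟨lam, hμ, hmany⟩ := exists_hasManyTypes μ
    exact hmany.not_stableIn hK.isAEC hap (hstable lam hμ)
  · rintro ⟨μ, hstable⟩
    obtain ⟨lam, hμ, hmany⟩ := exists_hasManyTypes μ
    obtain ⟨κ, hκ, M, _, hM, hle⟩ := hstable lam hμ
    obtain ⟨A, hA, hcard, hlt⟩ := hmany.exists_lt_mk_orbitTypes hK.isAEC hκ hM
    exact hlt.not_ge (hle A hA hcard)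

theorem theorem1p5 (L : FirstOrder.Language.{0, 0}) [L.IsAlgebraic] [Countable L.Symbols]
    (V : AlgVariety L) (hV : AlgVariety.RCP.{u} V)
    (K : StrongClass.{u} L) (hcov : K.IsCovering V) (hstrong : K.IsStrongEnough V) :
    ¬ K.Superstable ∧ ¬ K.MonsterSuperstable :=
  theorem1p5_general L V hV K
    ⟨hcov.mem_of_isFreeInf, hcov.isAEC, hcov.strong_of_freeFactor⟩ hcov.ap hstrong.qfDcl_eq
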